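/- There are absolute constants $C_1,C_2,C_3,C_4,C_5>0$ such that the following holds. Let $\varepsilon,\delta\in(0,1)$, let $\gamma\in\mathbb{R}$ with $0<|\gamma|<\varepsilon$, let $m\ge 1$ and $d$ be integers, and let $T,k,l$ be natural numbers with $$T\ \ge\ C_3\Bigl(1+\log\tfrac1\varepsilon\Bigr),\qquad k\ \ge\ C_4\Bigl(1+\log\tfrac1\delta\Bigr)\Bigl(1+\log\tfrac1\varepsilon\Bigr)$$ (so that, for $\varepsilon,\delta$ bounded away from $1$, one may take $T=O(\log\frac1\varepsilon)$ and $k=O(\log\frac1\delta\log\frac1\varepsilon)$) and $$l>\frac{(\log m+C_2)^2}{C_1\varepsilon^2},\qquad l>\frac{\log(Tk/\delta)}{\varepsilon^2}.$$ Put $n=2Tkl$; then $n\ge C_5/\varepsilon^2$, i.e. $n=\Omega(1/\varepsilon^2)$. Let $\{\Pi^{(c)}_{s,j}\}$, $c\in[m]$, $s\in[2Tk]$, $j\in[l]$, be (self-adjoint, idempotent) projectors on $\mathbb{C}^d$. Then there is an algorithm, i.e. a measurement (POVM with finitely many outcomes) on $(\mathbb{C}^d)^{\otimes n}$ which may depend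 on all the data above and whose outcomes are pairs $(c^*,\hat\mu_{c^*}(\gamma))\in[m]\times\mathbb{R}$, with the following property. Let $\rho=\rho_1\otimes\cdots\otimes\rho_{2Tk}$ be any product state with blocks $\rho_s=\rho_{s,1}\otimes\cdots\otimes\rho_{s,l}$, where the $\rho_{s,j}$ are (unknown, possibly all different) density matrices on $\mathbb{C}^d$, and let $\mu_1(\gamma),\dots,\mu_m(\gamma)\in[0,1]$ be any (unknown) numbers such that $$\left|\frac1\gamma\log\Bigl(\frac1l\sum_{j=1}^l e^{\gamma\,\mathrm{Tr}[\rho_{s,j}\Pi^{(c)}_{s,j}]}\Bigr)-\mu_c(\gamma)\right|\le\frac{\varepsilon}{4}\qquad\text{for all }c\in[m],\ s\in[2Tk].$$ Then the output of the algorithm on a single copy of $\rho$ satisfies $$\Pr\Bigl(\bigl|\hat\mu_{c^*}(\gamma)-\max_{c\in[m]}\mu_c(\gamma)\bigr|\ge\varepsilon\ \text{ or }\ \bigl|\hat\mu_{c^*}(\gamma)-\mu_{c^*}(\gamma)\bigr|\ge\varepsilon\Bigr)\le\delta .$$ -/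

import Mathlib

open scoped ComplexOrder

noncomputable section

namespace QTERM

/-- A density matrix (quantum state) on the finite-dimensional Hilbert space `ℂ^ι`. -/
structure IsDensity {ι : Type*} [Fintype ι] (ρ : Matrix ι ι ℂ) : Prop where
  posSemidef : ρ.PosSemidef
  trace_eq_one : ρ.trace = 1

/-- The tensor product `⨂ i, ρ i` of a family of operators on `ℂ^d`, as a matrix on
`(ℂ^d)^{⊗ I}`, whose standard basis is indexed by `I → Fin d`. -/
def productState {I : Type*} [Fintype I] {d : ℕ} (ρ : I → Matrix (Fin d) (Fin d) ℂ) :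
    Matrix (I → Fin d) (I → Fin d) ℂ :=
  Matrix.of fun x y => ∏ i, ρ i (x i) (y i)

/-- The expectation `E_ρ[P] = Tr[ρ P]` (a real number for `ρ`, `P` Hermitian). -/
def expect {ι : Type*} [Fintype ι] (ρ P : Matrix ι ι ℂ) : ℝ :=
  ((ρ * P).trace).re

/-- The tilted mean `(1/γ) log ((1/l) ∑ j, exp (γ Tr[ρ_j Π_j]))` of a list of `l` states and
`l` projectors; the tilted empirical risk is one minus this quantity. -/
def tiltedMean {d l : ℕ} (γ : ℝ) (ρ P : Fin l → Matrix (Fin d) (Fin d) ℂ) : ℝ :=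
  (1 / γ) * Real.log ((1 / (l : ℝ)) * ∑ j, Real.exp (γ * expect (ρ j) (P j)))

/-- An algorithm acting on a single copy of a quantum state on `ℂ^ι` and returning a hypothesis
index in `[m]` together with a real number: a measurement (POVM) with finitely many outcomes,
each outcome being labelled with the pair that is then output. -/
structure LearningAlgorithm (ι : Type*) [Fintype ι] [DecidableEq ι] (m : ℕ) where
  /-- the number of measurement outcomes -/
  outcomes : ℕ
  /-- the POVM elements -/
  effect : Fin outcomes → Matrix ι ι ℂ
  effect_posSemidef : ∀ o, (effect o).PosSemidef
  effect_sum : ∑ o, effect o = 1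
  /-- the hypothesis index `c*` that is output -/
  concept : Fin outcomes → Fin m
  /-- the estimated value that is output -/
  estimate : Fin outcomes → ℝ

open Classical in
/-- The probability, on input state `σ`, that the output `(c*, v)` of the algorithm has the
property `bad` (Born's rule). -/
def LearningAlgorithm.prob {ι : Type*} [Fintype ι] [DecidableEq ι] {m : ℕ}
    (A : LearningAlgorithm ι m) (σ : Matrix ι ι ℂ) (bad : Fin m → ℝ → Prop) : ℝ :=
  ∑ o with bad (A.concept o) (A.estimate o), expect σ (A.effect o)

end QTERM

end

/-! Since `|γ| < ε`, the tilted mean differs from the ordinary mean plus `γ/16` by at most `ε/16`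
(`abs_log_mean_exp_sub_le`), so it suffices to find an index with nearly maximal mean expectation
and to estimate that mean.

The blocks form `k` independent groups, each with a search half and a verification half of `N = T *
l` sites. Searching (`exists_search`) is a pretty-good measurement for the weights `W c = ⨂ j, (1 +
t • P c j)`. For `t` of order `1/√N`, the expectation of `W c` is about `exp (t * ∑ j, x c j)`,
which exponentially favours large means, while its relative variance stays bounded by a small
constant. Hence `A = ∑ c, W c` is concentrated, and sandwiching by `A^{-1/2}` acts on the state
almost like division by the expectation of `A` (`exists_prettyGood`). Clearly suboptimal indices
then appear with probability at most `1/2`.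

Verification measures the projectors of the index found on fresh sites, with Hoeffding error
(`sum_bernoulli_tail_le`). If all estimates are accurate and one search succeeds, the largest
estimate is correct: accuracy bounds it above, the successful group bounds it below. Failure costs
`2^{-k}` plus `k` Hoeffding tails. -/

namespace QTERM

open Matrix
open scoped MatrixOrder Kronecker

/-! ### Expectations in a state: linearity, positivity, monotonicity. -/

section Expect

variable {n : Type*} [Fintype n]

lemma expect_add (ρ A B : Matrix n n ℂ) : expect ρ (A + B) = expect ρ A + expect ρ B := by
  simp [expect, mul_add]

lemma expect_sub (ρ A B : Matrix n n ℂ) : expect ρ (A - B) = expect ρ A - expect ρ B := by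
  simp [expect, mul_sub]

lemma expect_smul (ρ A : Matrix n n ℂ) (r : ℝ) : expect ρ (r • A) = r * expect ρ A := by
  simp [expect]

lemma expect_sum {ι : Type*} (s : Finset ι) (ρ : Matrix n n ℂ) (A : ι → Matrix n n ℂ) :
    expect ρ (∑ i ∈ s, A i) = ∑ i ∈ s, expect ρ (A i) := by
  simp [expect, Finset.mul_sum, trace_sum]

lemma IsDensity.expect_one [DecidableEq n] {ρ : Matrix n n ℂ} (hρ : IsDensity ρ) :
    expect ρ 1 = 1 := by
  simp [expect, hρ.trace_eq_one]

/-- Writing `A = star B * B`, cyclicity turns the trace into that of `B * ρ * star B`. -/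
lemma trace_mul_nonneg {ρ A : Matrix n n ℂ} (hρ : ρ.PosSemidef) (hA : A.PosSemidef) :
    0 ≤ (ρ * A).trace := by
  classical
  obtain ⟨B, rfl⟩ := CStarAlgebra.nonneg_iff_eq_star_mul_self.mp hA.nonneg
  rw [← mul_assoc, trace_mul_comm, ← mul_assoc]
  exact (hρ.mul_mul_conjTranspose_same B).trace_nonneg

lemma expect_nonneg {ρ A : Matrix n n ℂ} (hρ : ρ.PosSemidef) (hA : A.PosSemidef) :
    0 ≤ expect ρ A :=
  (Complex.le_def.mp (trace_mul_nonneg hρ hA)).1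

lemma trace_mul_eq_expect {ρ A : Matrix n n ℂ} (hρ : ρ.PosSemidef) (hA : A.PosSemidef) :
    (ρ * A).trace = (expect ρ A : ℂ) := by
  apply Complex.ext
  · simp [expect]
  · simpa using (Complex.le_def.mp (trace_mul_nonneg hρ hA)).2.symm

lemma expect_mono {ρ A B : Matrix n n ℂ} (hρ : ρ.PosSemidef) (h : (B - A).PosSemidef) :
    expect ρ A ≤ expect ρ B := by
  have := expect_nonneg hρ h
  rw [expect_sub] at this
  linarith

lemma expect_submatrix {m : Type*} [Fintype m] (e : m ≃ n) (ρ A : Matrix n n ℂ) :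
    expect (ρ.submatrix e e) (A.submatrix e e) = expect ρ A := by
  simp only [expect, submatrix_mul_equiv]
  congr 1
  exact Equiv.sum_comp e fun i => (ρ * A) i i

end Expect

/-! ### Tensor products of matrices over a finite index set. -/

section TensorProducts

variable {I n : Type*} [Fintype I] [Fintype n]

/-- The tensor product `⨂ i, M i`, as a matrix indexed by `I → n`. -/
def piTensor (M : I → Matrix n n ℂ) : Matrix (I → n) (I → n) ℂ :=
  Matrix.of fun x y => ∏ i, M i (x i) (y i)

lemma piTensor_mul [DecidableEq I] (M N : I → Matrix n n ℂ) :
    piTensor M * piTensor N = piTensor fun i => M i * N i := by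
  ext x y
  simp only [piTensor, mul_apply, of_apply, ← Finset.prod_mul_distrib]
  rw [Fintype.prod_sum fun i j => M i (x i) j * N i j (y i)]

lemma trace_piTensor [DecidableEq I] (M : I → Matrix n n ℂ) :
    (piTensor M).trace = ∏ i, (M i).trace := by
  simp only [piTensor, trace, diag, of_apply]
  rw [Fintype.prod_sum fun i j => M i j j]

omit [Fintype n] in
lemma conjTranspose_piTensor (M : I → Matrix n n ℂ) :
    (piTensor M)ᴴ = piTensor fun i => (M i)ᴴ := by
  ext x y
  simp [piTensor]

omit [Fintype n] in
lemma piTensor_one [DecidableEq I] [DecidableEq n] : piTensor (fun _ : I => (1 : Matrix n n ℂ)) = 1 := by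
  ext x y
  by_cases h : x = y
  · subst h; simp [piTensor]
  · obtain ⟨i, hi⟩ := Function.ne_iff.mp h
    rw [one_apply_ne h]
    exact Finset.prod_eq_zero (Finset.mem_univ i) (one_apply_ne hi)

omit [Fintype n] in
lemma sum_piTensor [DecidableEq I] {O : Type*} [Fintype O] (M : I → O → Matrix n n ℂ) :
    ∑ o : I → O, piTensor (fun i => M i (o i)) = piTensor fun i => ∑ a, M i a := by
  ext x y
  simp only [piTensor, Matrix.sum_apply, of_apply]
  rw [Fintype.prod_sum fun i a => M i a (x i) (y i)]

lemma posSemidef_piTensor {M : I → Matrix n n ℂ} (hM : ∀ i, (M i).PosSemidef) :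
    (piTensor M).PosSemidef := by
  classical
  choose B hB using fun i => CStarAlgebra.nonneg_iff_eq_star_mul_self.mp (hM i).nonneg
  have : piTensor M = (piTensor B)ᴴ * piTensor B := by
    rw [conjTranspose_piTensor, piTensor_mul]
    congr 1
    exact funext hB
  rw [this]
  exact posSemidef_conjTranspose_mul_self _

/-- Positivity makes each factor's trace real; without it the real part of the product need not be
the product of the real parts. -/
lemma expect_piTensor [DecidableEq I] {ρ M : I → Matrix n n ℂ} (hρ : ∀ i, (ρ i).PosSemidef)
    (hM : ∀ i, (M i).PosSemidef) :
    expect (piTensor ρ) (piTensor M) = ∏ i, expect (ρ i) (M i) := by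
  have h : (piTensor ρ * piTensor M).trace = ((∏ i, expect (ρ i) (M i) : ℝ) : ℂ) := by
    rw [piTensor_mul, trace_piTensor, Complex.ofReal_prod]
    exact Finset.prod_congr rfl fun i _ => trace_mul_eq_expect (hρ i) (hM i)
  rw [expect, h, Complex.ofReal_re]

lemma expect_kronecker {m : Type*} [Fintype m] {ρ A : Matrix n n ℂ} {σ B : Matrix m m ℂ}
    (hρ : ρ.PosSemidef) (hA : A.PosSemidef) (hσ : σ.PosSemidef) (hB : B.PosSemidef) :
    expect (ρ ⊗ₖ σ) (A ⊗ₖ B) = expect ρ A * expect σ B := by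
  rw [expect, ← mul_kronecker_mul, trace_kronecker, trace_mul_eq_expect hρ hA,
    trace_mul_eq_expect hσ hB, ← Complex.ofReal_mul, Complex.ofReal_re]

lemma IsDensity.piTensor [DecidableEq I] {ρ : I → Matrix n n ℂ} (hρ : ∀ i, IsDensity (ρ i)) :
    IsDensity (piTensor ρ) :=
  ⟨posSemidef_piTensor fun i => (hρ i).posSemidef, by
    simp [trace_piTensor, (hρ _).trace_eq_one]⟩

end TensorProducts

section Projections

variable {n : Type*} [Fintype n] {P : Matrix n n ℂ}

lemma posSemidef_of_isStarProjection (hP : IsStarProjection P) : P.PosSemidef :=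
  hP.nonneg.posSemidef

lemma expect_isStarProjection_mem_Icc [DecidableEq n] {ρ : Matrix n n ℂ} (hρ : IsDensity ρ)
    (hP : IsStarProjection P) : expect ρ P ∈ Set.Icc (0 : ℝ) 1 := by
  refine ⟨expect_nonneg hρ.posSemidef (posSemidef_of_isStarProjection hP), ?_⟩
  rw [← hρ.expect_one]
  exact expect_mono hρ.posSemidef (posSemidef_of_isStarProjection hP.one_sub)

end Projections

/-! ### The pretty-good measurement and its error for concentrated weights. -/

section PrettyGoodMeasurement

variable {n : Type*} [Fintype n] [DecidableEq n]

/-- A positive definite matrix has an invertible positive square root. -/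
lemma exists_sqrt_inv {A : Matrix n n ℂ} (hA : A.PosDef) :
    ∃ Q X : Matrix n n ℂ, Q.PosSemidef ∧ X.IsHermitian ∧ Q * Q = A ∧ X * Q = 1 ∧ Q * X = 1 := by
  have hQ : (CFC.sqrt A).PosSemidef := (CFC.sqrt_nonneg A).posSemidef
  have hQQ : CFC.sqrt A * CFC.sqrt A = A := CFC.sqrt_mul_sqrt_self A hA.posSemidef.nonneg
  have hdet : IsUnit (CFC.sqrt A).det := by
    have h := (isUnit_iff_isUnit_det A).mp hA.isUnit
    rw [← hQQ, det_mul] at h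
    exact isUnit_of_mul_isUnit_left h
  exact ⟨_, (CFC.sqrt A)⁻¹, hQ, hQ.isHermitian.inv, hQQ, nonsing_inv_mul _ hdet,
    mul_nonsing_inv _ hdet⟩

/-- Sandwiching `T ≤ A` between inverse square roots `X` of `A` is controlled by `T` and by the
deviation of the rescaled `A` from the identity. -/
lemma expect_sandwich_le {ρ A T Q X : Matrix n n ℂ} (hρ : IsDensity ρ) (hT : T.PosSemidef)
    (hTA : (A - T).PosSemidef) (hQ : Q.PosSemidef) (hX : X.IsHermitian) (hQQ : Q * Q = A)
    (hXQ : X * Q = 1) (hQX : Q * X = 1) {r : ℝ} (hr : 0 ≤ r) :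
    expect ρ (X * T * X) ≤
      2 * r ^ 2 * expect ρ T + 2 * expect ρ ((1 - r ^ 2 • A) * (1 - r ^ 2 • A)) := by
  have conj {B Y : Matrix n n ℂ} (hB : B.PosSemidef) (hY : Y.IsHermitian) :
      0 ≤ expect ρ (Y * B * Y) := by
    have h := hB.mul_mul_conjTranspose_same Y
    rw [hY.eq] at h
    exact expect_nonneg hρ.posSemidef h
  have herm (s : ℝ) : (s • (1 : Matrix n n ℂ)).IsHermitian := by
    simp [IsHermitian, conjTranspose_smul]
  have hA : A.PosSemidef := by simpa using hTA.add hT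
  -- With `X = r + (X - r)`, this is the operator form of `(a + b)² ≤ 2a² + 2b²`, weighted by `T`;
  -- `h6` expands it.
  have h1 := conj hT (hX.sub (herm (2 * r)))
  have h2 := conj hTA (hX.sub (herm r))
  have h3 : (X - r • 1) * A * (X - r • 1) = (1 - r • Q) * (1 - r • Q) := by
    rw [← hQQ, ← mul_assoc, mul_assoc]
    simp only [sub_mul, mul_sub, hXQ, hQX, Matrix.smul_mul, Matrix.mul_smul, one_mul, mul_one]
  -- This gives `(1 - r Q)² ≤ (1 - r² A)²`: the right side is `(1 - r Q)(1 + r Q)²(1 - r Q)`, and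
  -- `(1 + r Q)² - 1 = 2 r Q + r² A` is positive.
  have h4 : 0 ≤ expect ρ ((1 - r • Q) * ((2 * r) • Q + r ^ 2 • A) * (1 - r • Q)) := by
    refine conj ((hQ.smul (by positivity)).add (hA.smul (by positivity))) ?_
    have h := hQ.isHermitian
    simp only [IsHermitian, conjTranspose_sub, conjTranspose_one, conjTranspose_smul, h.eq,
      star_trivial]
  have h5 : (1 - r • Q) * ((2 * r) • Q + r ^ 2 • A) * (1 - r • Q) =
      (1 - r ^ 2 • A) * (1 - r ^ 2 • A) - (1 - r • Q) * (1 - r • Q) := by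
    rw [← hQQ]
    simp only [sub_mul, mul_sub, mul_add, add_mul, Matrix.smul_mul, Matrix.mul_smul, one_mul,
      mul_one, smul_smul, mul_assoc]
    module
  have h6 : (X - (2 * r) • 1) * T * (X - (2 * r) • 1) =
      (2 * r ^ 2) • T + (2 : ℝ) • ((X - r • 1) * T * (X - r • 1)) - X * T * X := by
    simp only [sub_mul, mul_sub, Matrix.smul_mul, Matrix.mul_smul, one_mul,
      mul_one, smul_sub, smul_smul, mul_assoc]
    module
  rw [mul_sub (X - r • 1), sub_mul (_ * A), h3, expect_sub] at h2
  rw [h5, expect_sub] at h4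
  rw [h6, expect_sub, expect_add, expect_smul, expect_smul] at h1
  linarith

/-- The relative second moment of a sum of Hermitian matrices is at most the largest relative
second moment of the summands. -/
lemma expect_sum_mul_sum_le {ι : Type*} [Fintype ι] {ρ : Matrix n n ℂ} (hρ : IsDensity ρ)
    {W : ι → Matrix n n ℂ} (hW : ∀ c, (W c).IsHermitian) (hpos : ∀ c, 0 < expect ρ (W c)) {κ : ℝ}
    (hκ : ∀ c, expect ρ (W c * W c) ≤ κ * expect ρ (W c) ^ 2) :
    expect ρ ((∑ c, W c) * ∑ c, W c) ≤ κ * (∑ c, expect ρ (W c)) ^ 2 := by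
  rcases isEmpty_or_nonempty ι with h | h
  · simp [expect]
  set A := ∑ c, W c with hA
  set K := ∑ c, expect ρ (W c) with hK
  have hK0 : 0 < K := Finset.sum_pos (fun c _ => hpos c) Finset.univ_nonempty
  have hAh : A.IsHermitian := by
    simp only [hA, IsHermitian, conjTranspose_sum, (hW _).eq]
  -- The square of `W c - (w/K) • A`, with `w = expect ρ (W c)`, has nonnegative expectation. Scaled
  -- by `K/w` and summed over `c`, the cross terms give `2 E[A²]` and the last terms `E[A²]`, so no
  -- commutation is needed.
  have key (c : ι) : expect ρ (W c * A) + expect ρ (A * W c) ≤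
      (K / expect ρ (W c)) * expect ρ (W c * W c) + (expect ρ (W c) / K) * expect ρ (A * A) := by
    have hc := hpos c
    have hYh : (W c - (expect ρ (W c) / K) • A)ᴴ = W c - (expect ρ (W c) / K) • A := by
      simp only [conjTranspose_sub, conjTranspose_smul, (hW c).eq, hAh.eq, star_trivial]
    have h := expect_nonneg hρ.posSemidef
      (posSemidef_conjTranspose_mul_self (W c - (expect ρ (W c) / K) • A))
    rw [hYh] at h
    simp only [sub_mul, mul_sub, Matrix.smul_mul, Matrix.mul_smul, expect_sub, expect_smul] at h
    have h' := mul_nonneg (div_pos hK0 hc).le h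
    have : K / expect ρ (W c) * (expect ρ (W c) / K) = 1 := by field_simp
    linear_combination h' - (expect ρ (W c * A) + expect ρ (A * W c)
      - (expect ρ (W c) / K) * expect ρ (A * A)) * this
  have hs := Finset.sum_le_sum fun c (_ : c ∈ Finset.univ) => key c
  rw [Finset.sum_add_distrib, Finset.sum_add_distrib, ← expect_sum, ← expect_sum,
    ← Finset.sum_mul, ← Finset.mul_sum, ← Finset.sum_mul, ← Finset.sum_div, ← hA, ← hK,
    div_self hK0.ne', one_mul] at hs
  have hb : ∑ c, K / expect ρ (W c) * expect ρ (W c * W c) ≤ ∑ c, K * κ * expect ρ (W c) := by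
    refine Finset.sum_le_sum fun c _ => ?_
    have hc := hpos c
    calc K / expect ρ (W c) * expect ρ (W c * W c)
        ≤ K / expect ρ (W c) * (κ * expect ρ (W c) ^ 2) := by gcongr; exact hκ c
      _ = K * κ * expect ρ (W c) := by field_simp
  rw [← Finset.mul_sum, ← hK] at hb
  linarith

/-- The pretty-good measurement `S c = A^{-1/2} W c A^{-1/2}`, `A = ∑ c, W c`: the probability of
an outcome in a set of low total weight is small when each `W c` is concentrated. -/
lemma exists_prettyGood {ι : Type*} [Fintype ι] {W : ι → Matrix n n ℂ}
    (hW : ∀ c, (W c).PosSemidef) (hA : (∑ c, W c).PosDef) :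
    ∃ S : ι → Matrix n n ℂ, (∀ c, (S c).PosSemidef) ∧ ∑ c, S c = 1 ∧
      ∀ (ρ : Matrix n n ℂ) (κ : ℝ) (bad : Finset ι), IsDensity ρ → (∀ c, 0 < expect ρ (W c)) →
        (∀ c, expect ρ (W c * W c) ≤ κ * expect ρ (W c) ^ 2) →
        ∑ c ∈ bad, expect ρ (S c) ≤
          2 * (∑ c ∈ bad, expect ρ (W c)) / (∑ c, expect ρ (W c)) + 2 * (κ - 1) := by
  classical
  obtain ⟨Q, X, hQ, hX, hQQ, hXQ, hQX⟩ := exists_sqrt_inv hA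
  refine ⟨fun c => X * W c * X, fun c => ?_, ?_, fun ρ κ bad hρ hpos hκ => ?_⟩
  · have h := (hW c).mul_mul_conjTranspose_same X
    rwa [hX.eq] at h
  · rw [← Finset.sum_mul, ← Finset.mul_sum, ← hQQ, ← mul_assoc, hXQ, one_mul, hQX]
  have hne : Nonempty ι := by
    by_contra h
    rw [not_nonempty_iff] at h
    have h0 := hA.isUnit
    simp only [Finset.univ_eq_empty, Finset.sum_empty, isUnit_zero_iff] at h0
    have h1 := hρ.expect_one
    rw [← h0] at h1
    simp [expect] at h1
  have hK0 : 0 < ∑ c, expect ρ (W c) := Finset.sum_pos (fun c _ => hpos c) Finset.univ_nonempty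
  have hTA : ((∑ c, W c) - ∑ c ∈ bad, W c).PosSemidef := by
    rw [← Finset.sum_compl_add_sum bad, add_sub_cancel_right]
    exact posSemidef_sum _ fun c _ => hW c
  -- Taking `r² = 1/K` makes the second term twice the relative variance of `A`, which is at most `κ
  -- - 1`.
  have h := expect_sandwich_le hρ (posSemidef_sum bad fun c _ => hW c) hTA hQ hX hQQ hXQ hQX
    (Real.sqrt_nonneg (∑ c, expect ρ (W c))⁻¹)
  rw [Real.sq_sqrt (inv_nonneg.mpr hK0.le)] at h
  have h2 := expect_sum_mul_sum_le hρ (fun c => (hW c).isHermitian) hpos hκ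
  simp only [sub_mul, mul_sub, Matrix.smul_mul, Matrix.mul_smul, expect_sub, expect_smul, one_mul,
    mul_one, hρ.expect_one] at h
  rw [expect_sum bad, expect_sum Finset.univ] at h
  rw [← expect_sum, ← Finset.sum_mul, ← Finset.mul_sum]
  set K := ∑ c, expect ρ (W c)
  have h3 : K⁻¹ * (K⁻¹ * expect ρ ((∑ c, W c) * ∑ c, W c)) ≤ κ := by
    calc _ ≤ K⁻¹ * (K⁻¹ * (κ * K ^ 2)) := by gcongr
      _ = κ := by field_simp
  rw [inv_mul_cancel₀ hK0.ne'] at h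
  refine h.trans ?_
  rw [mul_div_assoc, div_eq_inv_mul, ← mul_assoc]
  linarith

end PrettyGoodMeasurement

/-! ### Scalar inequalities of Hoeffding type. -/

section Scalar

/-- Hoeffding's lemma for a Bernoulli variable. -/
lemma one_add_exp_sub_one_mul_le {p : ℝ} (hp : p ∈ Set.Icc (0 : ℝ) 1) (t : ℝ) :
    1 + (Real.exp t - 1) * p ≤ Real.exp (t * p + t ^ 2 / 8) := by
  open MeasureTheory ProbabilityTheory in
  obtain ⟨h0, h1⟩ := hp
  set ν : Measure ℝ := ENNReal.ofReal p • Measure.dirac 1 + ENNReal.ofReal (1 - p) • Measure.dirac 0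
    with hν
  have hint (f : ℝ → ℝ) : ∫ x, f x ∂ν = p * f 1 + (1 - p) * f 0 := by
    have hi (y : ℝ) : Integrable f (Measure.dirac y) := integrable_dirac (by simp)
    rw [hν, integral_add_measure ((hi 1).smul_measure (by simp)) ((hi 0).smul_measure (by simp)),
      integral_smul_measure, integral_smul_measure, integral_dirac, integral_dirac,
      ENNReal.toReal_ofReal h0, ENNReal.toReal_ofReal (by linarith)]
    simp
  have : IsProbabilityMeasure ν := ⟨by
    simp only [hν, Measure.add_apply, Measure.smul_apply, measure_univ, smul_eq_mul, mul_one]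
    rw [← ENNReal.ofReal_add h0 (by linarith)]
    simp⟩
  have hb : ∀ᵐ x ∂ν, id x ∈ Set.Icc (0 : ℝ) 1 := by
    rw [ae_iff]
    simp [hν]
  have h := (hasSubgaussianMGF_of_mem_Icc (μ := ν) (X := id) (a := 0) (b := 1)
    aemeasurable_id hb).mgf_le t
  rw [mgf, hint, hint] at h
  simp only [id, mul_one, mul_zero, add_zero, zero_sub] at h
  have hc : ((((‖(1 : ℝ) - 0‖₊ / 2) ^ 2 : NNReal) : ℝ)) * t ^ 2 / 2 = t ^ 2 / 8 := by
    simp; ring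
  rw [hc] at h
  calc 1 + (Real.exp t - 1) * p
      = Real.exp (t * p) * (p * Real.exp (t * (1 - p)) + (1 - p) * Real.exp (t * -p)) := by
        have e1 : Real.exp (t * (1 - p)) = Real.exp t * Real.exp (t * -p) := by
          rw [← Real.exp_add]; ring_nf
        have e2 : Real.exp (t * p) * Real.exp (t * -p) = 1 := by
          rw [← Real.exp_add]; simp
        rw [e1]
        linear_combination (-(p * Real.exp t) - (1 - p)) * e2
    _ ≤ Real.exp (t * p) * Real.exp (t ^ 2 / 8) := by gcongr
    _ = Real.exp (t * p + t ^ 2 / 8) := (Real.exp_add _ _).symm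

/-- Chord bound for the convex function `exp`. -/
lemma exp_mul_le_one_add {x : ℝ} (hx : x ∈ Set.Icc (0 : ℝ) 1) (t : ℝ) :
    Real.exp (t * x) ≤ 1 + (Real.exp t - 1) * x := by
  have h := convexOn_exp.2 (Set.mem_univ t) (Set.mem_univ 0) hx.1 (sub_nonneg.mpr hx.2) (by ring)
  simp only [smul_eq_mul, mul_zero, add_zero, Real.exp_zero, mul_one] at h
  rw [mul_comm t x]
  linarith

/-- The log-mean-exponential of numbers in `[0, 1]` is the mean up to a one-sided Hoeffding
correction, which is centred here. -/
lemma abs_log_mean_exp_sub_le {l : ℕ} (hl : 0 < l) {γ : ℝ} (hγ : γ ≠ 0) {x : Fin l → ℝ}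
    (hx : ∀ j, x j ∈ Set.Icc (0 : ℝ) 1) :
    |(1 / γ) * Real.log ((1 / (l : ℝ)) * ∑ j, Real.exp (γ * x j)) - ((∑ j, x j) / l + γ / 16)| ≤
      |γ| / 16 := by
  have hl' : (0 : ℝ) < l := by exact_mod_cast hl
  have hne : Nonempty (Fin l) := ⟨⟨0, hl⟩⟩
  set a := (∑ j, x j) / l with ha
  set E := (1 / (l : ℝ)) * ∑ j, Real.exp (γ * x j) with hE
  have hsum : ∑ j, x j = l * a := by rw [ha]; field_simp
  have hE0 : 0 < E := mul_pos (by positivity)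
    (Finset.sum_pos (fun j _ => Real.exp_pos _) Finset.univ_nonempty)
  have haI : a ∈ Set.Icc (0 : ℝ) 1 := by
    refine ⟨div_nonneg (Finset.sum_nonneg fun j _ => (hx j).1) hl'.le, (div_le_one hl').mpr ?_⟩
    calc ∑ j, x j ≤ ∑ _j : Fin l, (1 : ℝ) := Finset.sum_le_sum fun j _ => (hx j).2
      _ = l := by simp
  -- The chord bound replaces the `x j` by a Bernoulli variable of mean `a`, to which Hoeffding's
  -- lemma applies.
  have hup : Real.log E ≤ γ * a + γ ^ 2 / 8 := by
    rw [Real.log_le_iff_le_exp hE0]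
    refine le_trans ?_ (one_add_exp_sub_one_mul_le haI γ)
    calc E ≤ (1 / (l : ℝ)) * ∑ j, (1 + (Real.exp γ - 1) * x j) := by
          rw [hE]; gcongr with j; exact exp_mul_le_one_add (hx j) γ
      _ = 1 + (Real.exp γ - 1) * a := by
          rw [Finset.sum_add_distrib, ← Finset.mul_sum, hsum]
          simp only [Finset.sum_const, Finset.card_univ, Fintype.card_fin, nsmul_eq_mul]
          field_simp
  -- Jensen's inequality, through the tangent line of `exp` at `γ * a`. The interval `[γ a, γ a +
  -- γ²/8]` is then centred at `γ a + γ²/16`.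
  have hlow : γ * a ≤ Real.log E := by
    rw [Real.le_log_iff_exp_le hE0]
    calc Real.exp (γ * a)
        = (1 / (l : ℝ)) * ∑ j, Real.exp (γ * a) * ((γ * x j - γ * a) + 1) := by
          rw [← Finset.mul_sum, Finset.sum_add_distrib, Finset.sum_sub_distrib, ← Finset.mul_sum,
            hsum]
          simp only [Finset.sum_const, Finset.card_univ, Fintype.card_fin, nsmul_eq_mul]
          field_simp
          ring
      _ ≤ (1 / (l : ℝ)) * ∑ j, Real.exp (γ * a) * Real.exp (γ * x j - γ * a) := by
          gcongr with j; exact Real.add_one_le_exp _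
      _ = E := by
          rw [hE]
          congr 1
          refine Finset.sum_congr rfl fun j _ => ?_
          rw [← Real.exp_add]; ring_nf
  have heq : (1 / γ) * Real.log E - (a + γ / 16) = (Real.log E - γ * a - γ ^ 2 / 16) / γ := by
    field_simp
    ring
  rw [heq, abs_div, div_le_iff₀ (abs_pos.mpr hγ), div_mul_eq_mul_div, abs_mul_abs_self, abs_le]
  constructor <;> nlinarith

/-- Hoeffding's inequality for a sum of independent Bernoulli variables with parameters `x j`,
stated for the product weights on bit strings. -/
lemma sum_bernoulli_tail_le {J : Type*} [Fintype J] [DecidableEq J] {x : J → ℝ}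
    (hx : ∀ j, x j ∈ Set.Icc (0 : ℝ) 1) {η : ℝ} (hη : 0 ≤ η)
    (s : Finset (J → Bool))
    (hs : ∀ b ∈ s, (Fintype.card J : ℝ) * η ≤ |(∑ j, if b j then (1 : ℝ) else 0) - ∑ j, x j|) :
    ∑ b ∈ s, ∏ j, (if b j then x j else 1 - x j) ≤
      2 * Real.exp (-(2 * Fintype.card J * η ^ 2)) := by
  set w : (J → Bool) → ℝ := fun b => ∏ j, (if b j then x j else 1 - x j) with hw
  have hw0 (b : J → Bool) : 0 ≤ w b := Finset.prod_nonneg fun j _ => by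
    split_ifs
    · exact (hx j).1
    · exact sub_nonneg.mpr (hx j).2
  set D : (J → Bool) → ℝ := fun b => (∑ j, if b j then (1 : ℝ) else 0) - ∑ j, x j with hD
  have mgf (t : ℝ) : ∑ b, w b * Real.exp (t * D b) ≤ Real.exp (Fintype.card J * (t ^ 2 / 8)) := by
    have h1 (b : J → Bool) : w b * Real.exp (t * D b) =
        ∏ j, ((if b j then x j else 1 - x j) *
          Real.exp (t * ((if b j then (1 : ℝ) else 0) - x j))) := by
      rw [Finset.prod_mul_distrib, ← Real.exp_sum, ← Finset.mul_sum, Finset.sum_sub_distrib]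
    simp_rw [h1]
    rw [← Fintype.prod_sum fun j (β : Bool) => (if β then x j else 1 - x j) *
          Real.exp (t * ((if β then (1 : ℝ) else 0) - x j)), Real.exp_nat_mul,
      ← Finset.card_univ, ← Finset.prod_const]
    refine Finset.prod_le_prod (fun j _ => Finset.sum_nonneg fun β _ => mul_nonneg ?_
      (Real.exp_pos _).le) fun j _ => ?_
    · split_ifs
      · exact (hx j).1
      · exact sub_nonneg.mpr (hx j).2
    simp only [Fintype.univ_bool, Finset.mem_singleton, Bool.true_eq_false, not_false_eq_true,
      Finset.sum_insert, Finset.sum_singleton, if_true, Bool.false_eq_true, if_false, zero_sub]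
    have h := one_add_exp_sub_one_mul_le (hx j) t
    calc x j * Real.exp (t * (1 - x j)) + (1 - x j) * Real.exp (t * -x j)
        = (1 + (Real.exp t - 1) * x j) * Real.exp (-(t * x j)) := by
          rw [mul_sub, mul_one, sub_eq_add_neg, Real.exp_add, mul_neg]; ring
      _ ≤ Real.exp (t * x j + t ^ 2 / 8) * Real.exp (-(t * x j)) := by gcongr
      _ = Real.exp (t ^ 2 / 8) := by rw [← Real.exp_add]; ring_nf
  set N : ℝ := (Fintype.card J : ℝ)
  have hN : 0 ≤ N := Nat.cast_nonneg _
  -- `4 * η` minimises the Chernoff exponent `N t²/8 - t N η`; adding the tilts of both signs covers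
  -- both tails.
  have markov (b : J → Bool) (hb : b ∈ s) : w b ≤
      (w b * Real.exp (4 * η * D b) + w b * Real.exp (-(4 * η) * D b)) *
        Real.exp (-(4 * η * (N * η))) := by
    rw [← mul_add, mul_assoc]
    refine le_mul_of_one_le_right (hw0 b) ?_
    rw [add_mul, ← Real.exp_add, ← Real.exp_add]
    rcases le_abs'.mp (hs b hb) with h | h
    · have : 1 ≤ Real.exp (-(4 * η) * D b + -(4 * η * (N * η))) :=
        Real.one_le_exp (by nlinarith)
      linarith [Real.exp_pos (4 * η * D b + -(4 * η * (N * η)))]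
    · have : 1 ≤ Real.exp (4 * η * D b + -(4 * η * (N * η))) :=
        Real.one_le_exp (by nlinarith)
      linarith [Real.exp_pos (-(4 * η) * D b + -(4 * η * (N * η)))]
  calc ∑ b ∈ s, w b
      ≤ ∑ b ∈ s, (w b * Real.exp (4 * η * D b) + w b * Real.exp (-(4 * η) * D b)) *
        Real.exp (-(4 * η * (N * η))) := Finset.sum_le_sum markov
    _ ≤ ∑ b, (w b * Real.exp (4 * η * D b) + w b * Real.exp (-(4 * η) * D b)) *
        Real.exp (-(4 * η * (N * η))) := by
        refine Finset.sum_le_sum_of_subset_of_nonneg (Finset.subset_univ _) fun b _ _ => ?_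
        have := hw0 b
        positivity
    _ ≤ (Real.exp (N * ((4 * η) ^ 2 / 8)) + Real.exp (N * ((-(4 * η)) ^ 2 / 8))) *
        Real.exp (-(4 * η * (N * η))) := by
        rw [← Finset.sum_mul, Finset.sum_add_distrib]
        gcongr
        · exact mgf _
        · exact mgf _
    _ = 2 * Real.exp (-(2 * N * η ^ 2)) := by
        rw [neg_sq, ← two_mul, mul_assoc, ← Real.exp_add]
        ring_nf

end Scalar

/-! ### Finding a nearly optimal index with probability at least one half. -/

section Search

/-- For a projector `P` of mean `x`, `1 + t * x` and `1 + (2 * t + t ^ 2) * x` are the first two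
moments of `1 + t • P`. The variance `t² x (1 - x) ≤ t²/4` and a mean at least `1` give the last
bound. -/
lemma one_add_mul_bounds {x t : ℝ} (hx : x ∈ Set.Icc (0 : ℝ) 1) (ht : 0 ≤ t) :
    Real.exp (t * x - t ^ 2) ≤ 1 + t * x ∧ 1 + t * x ≤ Real.exp (t * x) ∧
      1 + (2 * t + t ^ 2) * x ≤ Real.exp (t ^ 2 / 4) * (1 + t * x) ^ 2 := by
  obtain ⟨h0, h1⟩ := hx
  have htx : 0 ≤ t * x := mul_nonneg ht h0
  refine ⟨?_, by linarith [Real.add_one_le_exp (t * x)], ?_⟩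
  · have hpos : 0 < 1 + t * x := by linarith
    rw [← Real.le_log_iff_exp_le hpos]
    refine le_trans ?_ (Real.one_sub_inv_le_log_of_pos hpos)
    rw [le_sub_iff_add_le, ← le_sub_iff_add_le', inv_le_iff_one_le_mul₀ hpos]
    have : (t * x) ^ 2 ≤ t ^ 2 := by
      have : x ^ 2 ≤ 1 := by nlinarith
      nlinarith [sq_nonneg t]
    nlinarith [mul_nonneg (sq_nonneg t) htx, mul_nonneg htx (sub_nonneg.mpr this)]
  · have h2 : 1 + t ^ 2 / 4 ≤ Real.exp (t ^ 2 / 4) := by linarith [Real.add_one_le_exp (t ^ 2 / 4)]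
    calc 1 + (2 * t + t ^ 2) * x ≤ (1 + t ^ 2 / 4) * (1 + t * x) ^ 2 := by
          nlinarith [mul_nonneg (sq_nonneg t) (sq_nonneg (x - 1 / 2)),
            mul_nonneg (sq_nonneg t) (add_nonneg htx (mul_nonneg htx htx)),
            mul_nonneg (sq_nonneg t) htx, mul_nonneg (sq_nonneg t) (sq_nonneg (t * x))]
      _ ≤ _ := by gcongr

variable {J : Type*} [Fintype J] [DecidableEq J] {d : ℕ}

/-- One measurement on a product state which, with probability at least `1 / 2`, returns an index
whose projectors have almost maximal mean expectation. -/
lemma exists_search {m : ℕ} (hm : 0 < m) (P : Fin m → J → Matrix (Fin d) (Fin d) ℂ)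
    (hP : ∀ c j, IsStarProjection (P c j)) {η : ℝ} (hJ : 0 < Fintype.card J)
    (hη : 2 * (Real.log m + 4) ≤ η * √(Fintype.card J)) :
    ∃ S : Fin m → Matrix (J → Fin d) (J → Fin d) ℂ, (∀ c, (S c).PosSemidef) ∧ ∑ c, S c = 1 ∧
      ∀ (ρ : J → Matrix (Fin d) (Fin d) ℂ), (∀ j, IsDensity (ρ j)) →
        ∀ (c₀ : Fin m) (bad : Finset (Fin m)),
          (∀ c ∈ bad, ∑ j, expect (ρ j) (P c j) ≤
            ∑ j, expect (ρ j) (P c₀ j) - Fintype.card J * η) →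
          ∑ c ∈ bad, expect (piTensor ρ) (S c) ≤ 1 / 2 := by
  have hN : (0 : ℝ) < Fintype.card J := by exact_mod_cast hJ
  set N : ℝ := (Fintype.card J : ℝ) with hNdef
  have hsN : 0 < √N := Real.sqrt_pos.mpr hN
  have hsq : √N * √N = N := Real.mul_self_sqrt hN.le
  -- Small enough that the relative second moment is at most `exp (N t²/4) = exp (1/16)`, large
  -- enough that `t N η = η √N / 2` beats `log m + 4`.
  set t : ℝ := 1 / (2 * √N) with ht
  have ht0 : 0 < t := by positivity
  have htN : N * t ^ 2 = 1 / 4 := by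
    rw [ht, div_pow, mul_pow, sq (√N), hsq]; field_simp; norm_num
  have htη : 2 * (t * (N * η)) = η * √N := by
    have h : t * N = √N / 2 := by
      rw [ht, div_mul_eq_mul_div, div_eq_iff (by positivity)]; linarith
    linear_combination 2 * η * h
  set V : Fin m → J → Matrix (Fin d) (Fin d) ℂ := fun c j => 1 + t • P c j with hV
  have hPS (c j) : (P c j).PosSemidef := posSemidef_of_isStarProjection (hP c j)
  have hVS (c j) : (V c j).PosSemidef := PosSemidef.one.add ((hPS c j).smul ht0.le)
  -- An explicit inverse makes every weight, hence their sum, positive definite, so that `A^{-1/2}`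
  -- exists.
  have hVinv (c j) : V c j * (1 - (t / (1 + t)) • P c j) = 1 := by
    simp only [hV, mul_sub, add_mul, one_mul, mul_one, Matrix.smul_mul, Matrix.mul_smul,
      (hP c j).isIdempotentElem.eq, smul_smul]
    rw [sub_eq_iff_eq_add, add_right_inj, ← add_smul]
    congr 1
    field_simp
  have hVV (c j) : V c j * V c j = 1 + (2 * t + t ^ 2) • P c j := by
    simp only [hV, mul_add, add_mul, one_mul, mul_one, Matrix.smul_mul, Matrix.mul_smul,
      (hP c j).isIdempotentElem.eq, smul_smul]
    module
  have hWS (c) : (piTensor (V c)).PosSemidef := posSemidef_piTensor (hVS c)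
  have hWD (c) : (piTensor (V c)).PosDef := by
    rw [(hWS c).posDef_iff_isUnit]
    refine .of_mul_eq_one (piTensor fun j => 1 - (t / (1 + t)) • P c j) ?_
    rw [piTensor_mul, ← piTensor_one]
    congr 1
    exact funext (hVinv c)
  have hAD : (∑ c, piTensor (V c)).PosDef := by
    rw [← Finset.add_sum_erase _ _ (Finset.mem_univ (⟨0, hm⟩ : Fin m))]
    exact (hWD _).add_posSemidef (posSemidef_sum _ fun c _ => hWS c)
  obtain ⟨S, hS, hS1, hbound⟩ := exists_prettyGood hWS hAD
  refine ⟨S, hS, hS1, fun ρ hρ c₀ bad hbad => ?_⟩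
  set x : Fin m → J → ℝ := fun c j => expect (ρ j) (P c j) with hx
  have hxI (c j) : x c j ∈ Set.Icc (0 : ℝ) 1 := expect_isStarProjection_mem_Icc (hρ j) (hP c j)
  have hρS (j) := (hρ j).posSemidef
  have hK (c) : expect (piTensor ρ) (piTensor (V c)) = ∏ j, (1 + t * x c j) := by
    rw [expect_piTensor hρS (hVS c)]
    simp only [hV, expect_add, expect_smul, (hρ _).expect_one, hx]
  have hK2 (c) : expect (piTensor ρ) (piTensor (V c) * piTensor (V c)) =
      ∏ j, (1 + (2 * t + t ^ 2) * x c j) := by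
    rw [piTensor_mul]
    simp only [hVV]
    rw [expect_piTensor hρS fun j => PosSemidef.one.add ((hPS c j).smul (by positivity))]
    simp only [expect_add, expect_smul, (hρ _).expect_one, hx]
  have hfac (c j) : 0 < 1 + t * x c j := by
    have := mul_nonneg ht0.le (hxI c j).1
    linarith
  have hpos (c) : 0 < expect (piTensor ρ) (piTensor (V c)) := by
    rw [hK]; exact Finset.prod_pos fun j _ => hfac c j
  have hκ (c) : expect (piTensor ρ) (piTensor (V c) * piTensor (V c)) ≤
      Real.exp (1 / 16) * expect (piTensor ρ) (piTensor (V c)) ^ 2 := by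
    rw [hK, hK2]
    have : Real.exp (1 / 16) = ∏ _j : J, Real.exp (t ^ 2 / 4) := by
      rw [Finset.prod_const, Finset.card_univ, ← Real.exp_nat_mul, ← hNdef]
      congr 1
      linarith
    rw [this, ← Finset.prod_pow, ← Finset.prod_mul_distrib]
    refine Finset.prod_le_prod (fun j _ => ?_) fun j _ => (one_add_mul_bounds (hxI c j) ht0.le).2.2
    have := (hxI c j).1
    positivity
  have hupper (c) : expect (piTensor ρ) (piTensor (V c)) ≤ Real.exp (t * ∑ j, x c j) := by
    rw [hK, Finset.mul_sum, Real.exp_sum]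
    exact Finset.prod_le_prod (fun j _ => (hfac c j).le) fun j _ =>
      (one_add_mul_bounds (hxI c j) ht0.le).2.1
  have hlower : Real.exp (t * ∑ j, x c₀ j - 1 / 4) ≤ ∑ c, expect (piTensor ρ) (piTensor (V c)) := by
    refine le_trans ?_ (Finset.single_le_sum (fun c _ => (hpos c).le) (Finset.mem_univ c₀))
    have : t * ∑ j, x c₀ j - 1 / 4 = ∑ j, (t * x c₀ j - t ^ 2) := by
      rw [Finset.sum_sub_distrib, ← Finset.mul_sum, Finset.sum_const, Finset.card_univ,
        nsmul_eq_mul, ← hNdef, htN]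
    rw [this, Real.exp_sum, hK]
    exact Finset.prod_le_prod (fun j _ => (Real.exp_pos _).le) fun j _ =>
      (one_add_mul_bounds (hxI c₀ j) ht0.le).1
  have hm' : (0 : ℝ) < m := by exact_mod_cast hm
  -- The at most `m` bad weights each lose a factor `exp (-t N η) ≤ exp (-4) / m` against the
  -- optimum; the slack absorbs the `1/4` in `hlower`. This term and the variance term each
  -- contribute at most `1/4` in the end.
  have hbadsum : ∑ c ∈ bad, expect (piTensor ρ) (piTensor (V c)) ≤
      1 / 8 * Real.exp (t * ∑ j, x c₀ j - 1 / 4) := by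
    have he : Real.exp (-3) ≤ 1 / 8 := by
      rw [Real.exp_neg, one_div]
      apply inv_anti₀ (by norm_num)
      have h2 : (2 : ℝ) ≤ Real.exp 1 := by linarith [Real.add_one_le_exp (1 : ℝ)]
      calc (8 : ℝ) = 2 ^ 3 := by norm_num
        _ ≤ Real.exp 1 ^ 3 := by gcongr
        _ = Real.exp 3 := by rw [← Real.exp_nat_mul]; norm_num
    calc ∑ c ∈ bad, expect (piTensor ρ) (piTensor (V c))
        ≤ ∑ _c ∈ bad, Real.exp (t * (∑ j, x c₀ j - N * η)) :=
          Finset.sum_le_sum fun c hc => (hupper c).trans (by gcongr; exact hbad c hc)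
      _ ≤ m * Real.exp (t * (∑ j, x c₀ j - N * η)) := by
          rw [Finset.sum_const, nsmul_eq_mul]
          gcongr
          simpa using Finset.card_le_univ bad
      _ = Real.exp (Real.log m + t * (∑ j, x c₀ j - N * η)) := by
          rw [Real.exp_add, Real.exp_log hm']
      _ ≤ Real.exp (-3 + (t * ∑ j, x c₀ j - 1 / 4)) := by
          rw [Real.exp_le_exp]
          linarith
      _ = Real.exp (-3) * Real.exp (t * ∑ j, x c₀ j - 1 / 4) := Real.exp_add _ _
      _ ≤ _ := by gcongr
  have hexp : Real.exp (1 / 16) ≤ 9 / 8 := by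
    have h1 : (15 / 16 : ℝ) ≤ Real.exp (-(1 / 16)) := by
      linarith [Real.add_one_le_exp (-(1 / 16) : ℝ)]
    have h2 : Real.exp (1 / 16) * Real.exp (-(1 / 16)) = 1 := by rw [← Real.exp_add]; simp
    nlinarith [Real.exp_pos (1 / 16)]
  refine (hbound (piTensor ρ) _ bad (.piTensor hρ) hpos hκ).trans ?_
  have hKpos := lt_of_lt_of_le (Real.exp_pos _) hlower
  have : 2 * (∑ c ∈ bad, expect (piTensor ρ) (piTensor (V c))) /
      (∑ c, expect (piTensor ρ) (piTensor (V c))) ≤ 1 / 4 := by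
    rw [div_le_iff₀ hKpos]
    linarith
  linarith

end Search

/-! ### Measuring the projectors of a fixed index; independent groups. -/

section Verification

variable {J : Type*} [Fintype J] [DecidableEq J] {d : ℕ}

/-- The effect of obtaining the bit string `b` when measuring all the projectors `P j`. -/
def bitEffect (P : J → Matrix (Fin d) (Fin d) ℂ) (b : J → Bool) :
    Matrix (J → Fin d) (J → Fin d) ℂ :=
  piTensor fun j => if b j then P j else 1 - P j

variable {P : J → Matrix (Fin d) (Fin d) ℂ}

omit [Fintype J] [DecidableEq J] in
lemma posSemidef_bit (hP : ∀ j, IsStarProjection (P j)) (b : J → Bool) (j : J) :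
    (if b j then P j else 1 - P j).PosSemidef := by
  split_ifs
  · exact posSemidef_of_isStarProjection (hP j)
  · exact posSemidef_of_isStarProjection (hP j).one_sub

omit [DecidableEq J] in
lemma posSemidef_bitEffect (hP : ∀ j, IsStarProjection (P j)) (b : J → Bool) :
    (bitEffect P b).PosSemidef :=
  posSemidef_piTensor (posSemidef_bit hP b)

lemma sum_bitEffect : ∑ b, bitEffect P b = 1 := by
  have h := sum_piTensor fun j (β : Bool) => if β then P j else 1 - P j
  simp only [bitEffect]
  rw [h, ← piTensor_one]
  congr 1
  ext1 j
  simp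

lemma expect_bitEffect (hP : ∀ j, IsStarProjection (P j)) {ρ : J → Matrix (Fin d) (Fin d) ℂ}
    (hρ : ∀ j, IsDensity (ρ j)) (b : J → Bool) :
    expect (piTensor ρ) (bitEffect P b) =
      ∏ j, (if b j then expect (ρ j) (P j) else 1 - expect (ρ j) (P j)) := by
  rw [bitEffect, expect_piTensor (fun j => (hρ j).posSemidef) (posSemidef_bit hP b)]
  refine Finset.prod_congr rfl fun j _ => ?_
  split_ifs
  · rfl
  · rw [expect_sub, (hρ j).expect_one]

end Verification

/-- A learning algorithm from a POVM whose outcomes are indexed by an arbitrary finite type. -/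
noncomputable def LearningAlgorithm.ofFintype {ι O : Type*} [Fintype ι] [DecidableEq ι] [Fintype O] {m : ℕ}
    (E : O → Matrix ι ι ℂ) (hE : ∀ o, (E o).PosSemidef) (hE1 : ∑ o, E o = 1)
    (concept : O → Fin m) (estimate : O → ℝ) : LearningAlgorithm ι m where
  outcomes := Fintype.card O
  effect i := E ((Fintype.equivFin O).symm i)
  effect_posSemidef _ := hE _
  effect_sum := by rw [← hE1]; exact Equiv.sum_comp _ E
  concept i := concept ((Fintype.equivFin O).symm i)
  estimate i := estimate ((Fintype.equivFin O).symm i)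

open Classical in
lemma LearningAlgorithm.prob_ofFintype {ι O : Type*} [Fintype ι] [DecidableEq ι] [Fintype O]
    {m : ℕ} {E : O → Matrix ι ι ℂ} (hE : ∀ o, (E o).PosSemidef) (hE1 : ∑ o, E o = 1)
    (concept : O → Fin m) (estimate : O → ℝ) (σ : Matrix ι ι ℂ) (bad : Fin m → ℝ → Prop) :
    (ofFintype E hE hE1 concept estimate).prob σ bad =
      ∑ o with bad (concept o) (estimate o), expect σ (E o) := by
  rw [prob, Finset.sum_filter, Finset.sum_filter]
  exact Equiv.sum_comp (Fintype.equivFin O).symm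
    fun o => if bad (concept o) (estimate o) then expect σ (E o) else 0

/-- For independent outcomes: the probability that either every outcome lies in its set `U g` or
some outcome lies in its set `R g`. -/
lemma sum_prod_le_prod_add_sum {G O : Type*} [Fintype G] [DecidableEq G] [Fintype O]
    [DecidableEq O] {w : G → O → ℝ} (hw : ∀ g a, 0 ≤ w g a) (hw1 : ∀ g, ∑ a, w g a = 1)
    (U R : G → Finset O) (s : Finset (G → O))
    (hs : ∀ o ∈ s, (∀ g, o g ∈ U g) ∨ ∃ g, o g ∈ R g) :
    ∑ o ∈ s, ∏ g, w g (o g) ≤ (∏ g, ∑ a ∈ U g, w g a) + ∑ g, ∑ a ∈ R g, w g a := by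
  have hU : ∏ g, ∑ a ∈ U g, w g a = ∑ o : G → O, ∏ g, if o g ∈ U g then w g (o g) else 0 := by
    rw [← Fintype.prod_sum fun g a => if a ∈ U g then w g a else 0]
    refine Finset.prod_congr rfl fun g _ => ?_
    rw [← Finset.sum_filter, Finset.filter_univ_mem]
  -- The indicator of an event in coordinate `g` is written as a product over all coordinates, so
  -- the sum factorises and the other factors are total masses `1`.
  have hR (g : G) : ∑ a ∈ R g, w g a =
      ∑ o : G → O, if o g ∈ R g then ∏ g', w g' (o g') else 0 := by
    have h1 (o : G → O) : (if o g ∈ R g then ∏ g', w g' (o g') else 0) =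
        ∏ g', if g' = g → o g' ∈ R g then w g' (o g') else 0 := by
      split_ifs with h
      · refine Finset.prod_congr rfl fun g' _ => (if_pos ?_).symm
        rintro rfl
        exact h
      · exact (Finset.prod_eq_zero (Finset.mem_univ g) (by simp [h])).symm
    simp_rw [h1]
    rw [← Fintype.prod_sum fun g' a => if g' = g → a ∈ R g then w g' a else 0,
      ← Finset.mul_prod_erase _ _ (Finset.mem_univ g), Finset.prod_eq_one, mul_one]
    · simp only [forall_const]
      rw [← Finset.sum_filter, Finset.filter_univ_mem]
    · intro g' hg'
      rw [← hw1 g']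
      exact Finset.sum_congr rfl fun a _ => if_pos fun h => absurd h (Finset.ne_of_mem_erase hg')
  simp_rw [hR]
  rw [hU, Finset.sum_comm, ← Finset.sum_add_distrib]
  have hp (o : G → O) : 0 ≤ ∏ g, w g (o g) := Finset.prod_nonneg fun g _ => hw g _
  have hUn (o : G → O) : 0 ≤ ∏ g, if o g ∈ U g then w g (o g) else 0 :=
    Finset.prod_nonneg fun g _ => by split_ifs <;> simp [hw]
  have hRn (o : G → O) (g : G) : 0 ≤ if o g ∈ R g then ∏ g', w g' (o g') else 0 := by
    split_ifs <;> simp [hp]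
  refine le_trans (Finset.sum_le_sum fun o ho => ?_) (Finset.sum_le_sum_of_subset_of_nonneg
    (Finset.subset_univ s) fun o _ _ => add_nonneg (hUn o) (Finset.sum_nonneg fun g _ => hRn o g))
  rcases hs o ho with h | ⟨g, hg⟩
  · refine le_add_of_le_of_nonneg (le_of_eq ?_) (Finset.sum_nonneg fun g _ => hRn o g)
    exact Finset.prod_congr rfl fun g _ => (if_pos (h g)).symm
  · refine le_add_of_nonneg_of_le (hUn o) ?_
    refine le_trans (le_of_eq ?_) (Finset.single_le_sum (fun g _ => hRn o g) (Finset.mem_univ g))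
    exact (if_pos hg).symm

/-! ### Regrouping tensor factors and assembling the algorithm. -/

section Regrouping

variable {k B l d : ℕ} {T : Type*} [Fintype T]

/-- Splitting the tensor factors into groups, each made of two halves. -/
def regroup (β : Fin k × Bool × T ≃ Fin B) :
    (Fin B × Fin l → Fin d) ≃ (Fin k → (T × Fin l → Fin d) × (T × Fin l → Fin d)) where
  toFun x g := (fun p => x (β (g, false, p.1), p.2), fun p => x (β (g, true, p.1), p.2))
  invFun y i := bif (β.symm i.1).2.1 then (y (β.symm i.1).1).2 ((β.symm i.1).2.2, i.2)
    else (y (β.symm i.1).1).1 ((β.symm i.1).2.2, i.2)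
  left_inv x := by
    funext ⟨s, j⟩
    obtain ⟨⟨g, b, t⟩, rfl⟩ := β.surjective s
    cases b <;> simp
  right_inv y := by
    funext g
    simp

lemma productState_eq_submatrix (β : Fin k × Bool × T ≃ Fin B)
    (ρ : Fin B → Fin l → Matrix (Fin d) (Fin d) ℂ) :
    (productState fun i : Fin B × Fin l => ρ i.1 i.2) =
      (piTensor fun g => (piTensor fun p : T × Fin l => ρ (β (g, false, p.1)) p.2) ⊗ₖ
        (piTensor fun p : T × Fin l => ρ (β (g, true, p.1)) p.2)).submatrix
          (regroup β) (regroup β) := by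
  ext x y
  simp only [productState, piTensor, regroup, submatrix_apply, of_apply, kroneckerMap_apply,
    Equiv.coe_fn_mk, Fintype.prod_prod_type]
  rw [← β.prod_comp]
  simp only [Fintype.prod_prod_type, Fintype.univ_bool, Finset.mem_singleton, Bool.true_eq_false,
    not_false_eq_true, Finset.prod_insert, Finset.prod_singleton]
  -- `Fintype.univ_bool` lists `true` first, whereas the `false` half is the left Kronecker factor.
  exact Finset.prod_congr rfl fun g _ => mul_comm _ _

end Regrouping

/-- In `k` groups of `2 T` blocks each, search for a near-maximal index on one half of the group and
estimate its mean on the other half; the best estimate is close to the maximum and to the value of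
the index it belongs to. -/
lemma exists_learningAlgorithm {ε γ : ℝ} (hε : 0 < ε) (hγ0 : γ ≠ 0) (hγ : |γ| < ε)
    {T k l m d : ℕ} (hT : 0 < T) (hk : 0 < k) (hl : 0 < l) (hm : 0 < m)
    (hsearch : 2 * (Real.log m + 4) ≤ ε / 64 * √(T * l : ℕ))
    (P : Fin m → Fin (2 * T * k) → Fin l → Matrix (Fin d) (Fin d) ℂ)
    (hP : ∀ c s j, IsStarProjection (P c s j)) :
    ∃ A : LearningAlgorithm (Fin (2 * T * k) × Fin l → Fin d) m,
      ∀ ρ : Fin (2 * T * k) → Fin l → Matrix (Fin d) (Fin d) ℂ,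
        (∀ s j, IsDensity (ρ s j)) →
        ∀ μ : Fin m → ℝ, (∀ c s, |tiltedMean γ (ρ s) (P c s) - μ c| ≤ ε / 4) →
          A.prob (productState fun i : Fin (2 * T * k) × Fin l => ρ i.1 i.2)
              (fun c v => ε ≤ |v - ⨆ c', μ c'| ∨ ε ≤ |v - μ c|) ≤
            (1 / 2) ^ k + k * (2 * Real.exp (-(2 * (T * l : ℕ) * (ε / 64) ^ 2))) := by
  classical
  have hkne : Nonempty (Fin k) := ⟨⟨0, hk⟩⟩
  have hmne : Nonempty (Fin m) := ⟨⟨0, hm⟩⟩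
  let β : Fin k × Bool × Fin T ≃ Fin (2 * T * k) := Fintype.equivFinOfCardEq (by simp; ring)
  let J := Fin T × Fin l
  have hcard : Fintype.card J = T * l := by simp [J]
  set N : ℝ := ((T * l : ℕ) : ℝ) with hN
  have hN0 : 0 < N := by rw [hN]; exact_mod_cast Nat.mul_pos hT hl
  let PB : Bool → Fin k → Fin m → J → Matrix (Fin d) (Fin d) ℂ :=
    fun h g c p => P c (β (g, h, p.1)) p.2
  have hPB (h g c p) : IsStarProjection (PB h g c p) := hP _ _ _
  have hS (g : Fin k) := exists_search hm (PB false g) (hPB false g) (η := ε / 64)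
    (by rw [hcard]; exact Nat.mul_pos hT hl) (by rw [hcard]; exact hsearch)
  choose S hS0 hS1 hSb using hS
  -- Search on the `false` half, then measure on the `true` half the projectors of the index just
  -- found: an adaptive procedure as a single POVM.
  let E₁ : Fin k → Fin m × (J → Bool) →
      Matrix ((J → Fin d) × (J → Fin d)) ((J → Fin d) × (J → Fin d)) ℂ :=
    fun g a => S g a.1 ⊗ₖ bitEffect (PB true g a.1) a.2
  have hE₁0 (g a) : (E₁ g a).PosSemidef :=
    (hS0 g a.1).kronecker (posSemidef_bitEffect (hPB true g a.1) a.2)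
  have hE₁1 (g) : ∑ a, E₁ g a = 1 := by
    have hK (c : Fin m) : ∑ b, S g c ⊗ₖ bitEffect (PB true g c) b = S g c ⊗ₖ 1 := by
      rw [← sum_bitEffect (P := PB true g c)]
      ext i j
      simp [Matrix.sum_apply, kroneckerMap_apply, Finset.mul_sum]
    simp only [E₁, Fintype.sum_prod_type]
    simp_rw [hK]
    rw [← one_kronecker_one, ← hS1 g]
    ext i j
    simp [Matrix.sum_apply, kroneckerMap_apply, Finset.sum_mul]
  let φ := regroup (l := l) (d := d) β
  let E : (Fin k → Fin m × (J → Bool)) →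
      Matrix (Fin (2 * T * k) × Fin l → Fin d) (Fin (2 * T * k) × Fin l → Fin d) ℂ :=
    fun o => (piTensor fun g => E₁ g (o g)).submatrix φ φ
  have hE0 (o) : (E o).PosSemidef := (posSemidef_piTensor fun g => hE₁0 g (o g)).submatrix φ
  have hE1 : ∑ o, E o = 1 := by
    have h : ∑ o, E o = (∑ o : Fin k → Fin m × (J → Bool),
        piTensor fun g => E₁ g (o g)).submatrix φ φ := by
      ext x y
      simp [E, Matrix.sum_apply]
    rw [h, sum_piTensor]
    simp_rw [hE₁1]
    rw [piTensor_one, submatrix_one_equiv]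
  let est : Fin m × (J → Bool) → ℝ := fun a => (∑ p, if a.2 p then (1 : ℝ) else 0) / N + γ / 16
  have hbest (o : Fin k → Fin m × (J → Bool)) : ∃ g, ∀ g', est (o g') ≤ est (o g) :=
    Finite.exists_max fun g => est (o g)
  choose best hbest using hbest
  refine ⟨.ofFintype E hE0 hE1 (fun o => (o (best o)).1) fun o => est (o (best o)),
    fun ρ hρ μ hμ => ?_⟩
  rw [LearningAlgorithm.prob_ofFintype, productState_eq_submatrix β]
  let ρB : Bool → Fin k → J → Matrix (Fin d) (Fin d) ℂ := fun h g p => ρ (β (g, h, p.1)) p.2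
  have hρB (h g p) : IsDensity (ρB h g p) := hρ _ _
  let x : Bool → Fin k → Fin m → J → ℝ := fun h g c p => expect (ρB h g p) (PB h g c p)
  have hx (h g c p) : x h g c p ∈ Set.Icc (0 : ℝ) 1 :=
    expect_isStarProjection_mem_Icc (hρB h g p) (hPB h g c p)
  -- `5/16 = 1/4 + 1/16`: the hypothesis on `μ` plus the centred tilting error, with `|γ| < ε`.
  have hmean (h g c) : |∑ p, x h g c p - N * (μ c - γ / 16)| ≤ N * (5 / 16 * ε) := by
    have hl' : (0 : ℝ) < l := by exact_mod_cast hl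
    have hblock (t : Fin T) : |∑ j, x h g c (t, j) - l * (μ c - γ / 16)| ≤ l * (5 / 16 * ε) := by
      have h1 := abs_log_mean_exp_sub_le hl hγ0 (x := fun j => x h g c (t, j))
        fun j => hx h g c (t, j)
      have h2 := hμ c (β (g, h, t))
      rw [tiltedMean] at h2
      have h3 : ∑ j, x h g c (t, j) = l * ((∑ j, x h g c (t, j)) / l) := by field_simp
      rw [h3, ← mul_sub, abs_mul, abs_of_pos hl']
      refine mul_le_mul_of_nonneg_left ?_ hl'.le
      rw [abs_le] at h1 h2 ⊢
      constructor <;> linarith [h1.1, h1.2, h2.1, h2.2]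
    have h1 : ∑ p, x h g c p - N * (μ c - γ / 16) =
        ∑ t : Fin T, (∑ j, x h g c (t, j) - l * (μ c - γ / 16)) := by
      rw [Fintype.sum_prod_type, Finset.sum_sub_distrib]
      simp [hN]
      ring
    rw [h1]
    refine (Finset.abs_sum_le_sum_abs _ _).trans ((Finset.sum_le_sum fun t _ => hblock t).trans_eq ?_)
    simp [hN]
    ring
  obtain ⟨c₀, hc₀⟩ := Finite.exists_max μ
  have hsup : ⨆ c, μ c = μ c₀ :=
    le_antisymm (ciSup_le hc₀) (le_ciSup (Set.finite_range μ).bddAbove c₀)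
  let w : Fin k → Fin m × (J → Bool) → ℝ := fun g a =>
    expect (piTensor (ρB false g)) (S g a.1) *
      expect (piTensor (ρB true g)) (bitEffect (PB true g a.1) a.2)
  have hρS (h g) : IsDensity (piTensor (ρB h g)) := .piTensor (hρB h g)
  have hw0 (g a) : 0 ≤ w g a := mul_nonneg (expect_nonneg (hρS _ _).posSemidef (hS0 _ _))
    (expect_nonneg (hρS _ _).posSemidef (posSemidef_bitEffect (hPB _ _ _) _))
  have hbit1 (g c) : ∑ b, expect (piTensor (ρB true g)) (bitEffect (PB true g c) b) = 1 := by
    rw [← expect_sum, sum_bitEffect, (hρS _ _).expect_one]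
  have hS1' (g) : ∑ c, expect (piTensor (ρB false g)) (S g c) = 1 := by
    rw [← expect_sum, hS1, (hρS _ _).expect_one]
  have hw1 (g) : ∑ a, w g a = 1 := by
    simp only [w, Fintype.sum_prod_type, ← Finset.mul_sum, hbit1, mul_one, hS1']
  have hprob (o) : expect ((piTensor fun g => piTensor (ρB false g) ⊗ₖ
      piTensor (ρB true g)).submatrix φ φ) (E o) = ∏ g, w g (o g) := by
    rw [expect_submatrix, expect_piTensor
      (fun g => (hρS _ g).posSemidef.kronecker (hρS _ g).posSemidef) fun g => hE₁0 g (o g)]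
    exact Finset.prod_congr rfl fun g _ => expect_kronecker (hρS _ g).posSemidef (hS0 _ _)
      (hρS _ g).posSemidef (posSemidef_bitEffect (hPB _ _ _) _)
  rw [Finset.sum_congr rfl fun o _ => hprob o]
  let bad : Fin k → Finset (Fin m) := fun g =>
    {c | ∑ p, x false g c p ≤ ∑ p, x false g c₀ p - N * (ε / 64)}
  let dev : Fin k → Fin m → Finset (J → Bool) := fun g c =>
    {b | N * (ε / 64) ≤ |(∑ p, if b p then (1 : ℝ) else 0) - ∑ p, x true g c p|}
  let U : Fin k → Finset (Fin m × (J → Bool)) := fun g => bad g ×ˢ Finset.univ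
  let R : Fin k → Finset (Fin m × (J → Bool)) := fun g => {a | a.2 ∈ dev g a.1}
  have hUsum (g) : ∑ a ∈ U g, w g a ≤ 1 / 2 := by
    simp only [U, w, Finset.sum_product, ← Finset.mul_sum, hbit1, mul_one]
    refine hSb g (ρB false g) (hρB false g) c₀ (bad g) fun c hc => ?_
    rw [hcard]
    exact (Finset.mem_filter.mp hc).2
  have hdev (g c) : ∑ b ∈ dev g c, expect (piTensor (ρB true g)) (bitEffect (PB true g c) b) ≤
      2 * Real.exp (-(2 * N * (ε / 64) ^ 2)) := by
    have h := sum_bernoulli_tail_le (hx true g c) (by positivity : 0 ≤ ε / 64) (dev g c)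
      (fun b hb => by rw [hcard]; exact (Finset.mem_filter.mp hb).2)
    rw [hcard] at h
    refine le_trans (le_of_eq ?_) h
    exact Finset.sum_congr rfl fun b _ => expect_bitEffect (hPB true g c) (hρB true g) b
  have hRsum (g) : ∑ a ∈ R g, w g a ≤ 2 * Real.exp (-(2 * N * (ε / 64) ^ 2)) := by
    have h1 : ∑ a ∈ R g, w g a = ∑ c, expect (piTensor (ρB false g)) (S g c) *
        ∑ b ∈ dev g c, expect (piTensor (ρB true g)) (bitEffect (PB true g c) b) := by
      simp only [R, Finset.sum_filter, Fintype.sum_prod_type, w]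
      refine Finset.sum_congr rfl fun c _ => ?_
      rw [← Finset.sum_filter, Finset.filter_univ_mem, Finset.mul_sum]
    rw [h1]
    calc _ ≤ ∑ c, expect (piTensor (ρB false g)) (S g c) *
          (2 * Real.exp (-(2 * N * (ε / 64) ^ 2))) := Finset.sum_le_sum fun c _ =>
            mul_le_mul_of_nonneg_left (hdev g c) (expect_nonneg (hρS _ _).posSemidef (hS0 _ _))
      _ = _ := by rw [← Finset.sum_mul, hS1', one_mul]
  refine (sum_prod_le_prod_add_sum hw0 hw1 U R _ fun o ho => ?_).trans (add_le_add ?_ ?_)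
  · by_contra! hcon
    obtain ⟨⟨g, hg⟩, hR⟩ := hcon
    have hlin (g' : Fin k) : |est (o g') - μ (o g').1| ≤ 5 / 16 * ε + ε / 64 := by
      have h1 : |(∑ p, if (o g').2 p then (1 : ℝ) else 0) - ∑ p, x true g' (o g').1 p| <
          N * (ε / 64) := by
        simpa [R, dev] using hR g'
      have h2 := hmean true g' (o g').1
      have h3 : est (o g') - μ (o g').1 =
          ((∑ p, if (o g').2 p then (1 : ℝ) else 0) - N * (μ (o g').1 - γ / 16)) / N := by
        simp only [est]; field_simp; ring
      rw [h3, abs_div, abs_of_pos hN0, div_le_iff₀ hN0]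
      rw [abs_lt] at h1
      rw [abs_le] at h2 ⊢
      constructor <;> linarith [h1.1, h1.2, h2.1, h2.2]
    have hgood : μ c₀ - 10 / 16 * ε - ε / 64 ≤ μ (o g).1 := by
      have h1 : ∑ p, x false g c₀ p - N * (ε / 64) < ∑ p, x false g (o g).1 p := by
        simpa [U, bad] using hg
      have h2 := abs_le.mp (hmean false g (o g).1)
      have h3 := abs_le.mp (hmean false g c₀)
      have h4 : N * (μ c₀ - 10 / 16 * ε - ε / 64) ≤ N * μ (o g).1 := by
        linarith [h2.2, h3.1]
      exact le_of_mul_le_mul_left h4 hN0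
    have hb1 := abs_le.mp (hlin (best o))
    have hb2 := abs_le.mp (hlin g)
    have hb3 := hbest o g
    have hb4 := hc₀ (o (best o)).1
    have ho' := ((@Finset.mem_filter _ _ (_) _ _).mp ho).2
    rw [hsup] at ho'
    rcases ho' with h | h
    · rcases le_abs'.mp h with h | h <;> linarith [hb1.2, hb2.1]
    · rcases le_abs'.mp h with h | h <;> linarith [hb1.1, hb1.2]
  · calc ∏ g, ∑ a ∈ U g, w g a ≤ ∏ _g : Fin k, (1 / 2 : ℝ) :=
          Finset.prod_le_prod (fun g _ => Finset.sum_nonneg fun a _ => hw0 g a) fun g _ => hUsum g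
      _ = (1 / 2) ^ k := by simp
  · calc ∑ g, ∑ a ∈ R g, w g a ≤ ∑ _g : Fin k, 2 * Real.exp (-(2 * N * (ε / 64) ^ 2)) :=
          Finset.sum_le_sum fun g _ => hRsum g
      _ = k * (2 * Real.exp (-(2 * N * (ε / 64) ^ 2))) := by simp

end QTERM

/-! ### Choice of the constants. -/

theorem proposition1 :
    ∃ C₁ C₂ C₃ C₄ C₅ : ℝ, 0 < C₁ ∧ 0 < C₂ ∧ 0 < C₃ ∧ 0 < C₄ ∧ 0 < C₅ ∧
      ∀ (ε δ γ : ℝ), 0 < ε → ε < 1 → 0 < δ → δ < 1 → 0 < |γ| → |γ| < ε →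
      ∀ (T k l m d : ℕ), 0 < m →
        C₃ * (1 + Real.log (1 / ε)) ≤ (T : ℝ) →
        C₄ * ((1 + Real.log (1 / δ)) * (1 + Real.log (1 / ε))) ≤ (k : ℝ) →
        (Real.log m + C₂) ^ 2 / (C₁ * ε ^ 2) < (l : ℝ) →
        Real.log ((T : ℝ) * k / δ) / ε ^ 2 < (l : ℝ) →
        C₅ / ε ^ 2 ≤ ((2 * T * k * l : ℕ) : ℝ) ∧
        ∀ P : Fin m → Fin (2 * T * k) → Fin l → Matrix (Fin d) (Fin d) ℂ,
          (∀ c s j, IsStarProjection (P c s j)) →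
          ∃ A : QTERM.LearningAlgorithm (Fin (2 * T * k) × Fin l → Fin d) m,
            ∀ ρ : Fin (2 * T * k) → Fin l → Matrix (Fin d) (Fin d) ℂ,
              (∀ s j, QTERM.IsDensity (ρ s j)) →
              ∀ μ : Fin m → ℝ,
                (∀ c, 0 ≤ μ c ∧ μ c ≤ 1) →
                (∀ c s, |QTERM.tiltedMean γ (ρ s) (P c s) - μ c| ≤ ε / 4) →
                A.prob (QTERM.productState fun i : Fin (2 * T * k) × Fin l => ρ i.1 i.2)
                  (fun c v => ε ≤ |v - ⨆ c', μ c'| ∨ ε ≤ |v - μ c|) ≤ δ := by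
  -- `128 = 2 * 64` and `4` match `hsearch`; `4096 = 64 ^ 2` cancels the precision `ε/64` in the
  -- tail; `2` works for `k` because `2 * log 2 > 1`; the last constant is `(128 * 4) ^ 2`, from
  -- `log m ≥ 0`.
  refine ⟨(1 / 128) ^ 2, 4, 4096, 2, 16 * 128 ^ 2, by norm_num, by norm_num, by norm_num,
    by norm_num, by norm_num, ?_⟩
  intro ε δ γ hε hε1 hδ hδ1 hγ0 hγ T k l m d hm hT hk hl hl'
  have hlogε : 0 ≤ Real.log (1 / ε) := Real.log_nonneg (by rw [le_div_iff₀ hε]; linarith)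
  have hlogδ : 0 ≤ Real.log (1 / δ) := Real.log_nonneg (by rw [le_div_iff₀ hδ]; linarith)
  have hlogm : 0 ≤ Real.log m := Real.log_nonneg (by exact_mod_cast hm)
  have hT' : (4096 : ℝ) ≤ T := by linarith
  have hk' : 2 * (1 + Real.log (1 / δ)) ≤ k := by
    have := mul_nonneg (add_nonneg zero_le_one hlogδ) hlogε
    linarith
  have hk2 : (2 : ℝ) ≤ k := by linarith
  have hlsq : (128 * (Real.log m + 4) / ε) ^ 2 < l := by
    refine lt_of_eq_of_lt ?_ hl
    field_simp
  have hl0 : (0 : ℝ) < l := lt_of_le_of_lt (sq_nonneg _) hlsq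
  have hTpos : 0 < T := by
    have : (0 : ℝ) < T := by linarith
    exact_mod_cast this
  have hkpos : 0 < k := by
    have : (0 : ℝ) < k := by linarith
    exact_mod_cast this
  have hlpos : 0 < l := by exact_mod_cast hl0
  refine ⟨?_, fun P hP => ?_⟩
  · have h1 : 16 * 128 ^ 2 / ε ^ 2 ≤ (l : ℝ) := by
      refine le_trans ?_ hlsq.le
      rw [div_pow]
      gcongr
      nlinarith
    refine h1.trans ?_
    exact_mod_cast Nat.le_mul_of_pos_left l (by positivity)
  have hsearch : 2 * (Real.log m + 4) ≤ ε / 64 * √(T * l : ℕ) := by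
    have h1 : 128 * (Real.log m + 4) / ε ≤ √(T * l : ℕ) := by
      apply Real.le_sqrt_of_sq_le
      refine hlsq.le.trans ?_
      exact_mod_cast Nat.le_mul_of_pos_left l hTpos
    rw [div_le_iff₀ hε] at h1
    linarith
  obtain ⟨A, hA⟩ := QTERM.exists_learningAlgorithm hε (abs_pos.mp hγ0) hγ hTpos hkpos hlpos hm
    hsearch P hP
  refine ⟨A, fun ρ hρ μ _ hμ => (hA ρ hρ μ hμ).trans ?_⟩
  have hhalf : ((1 : ℝ) / 2) ^ k ≤ δ / 2 := by
    rw [← Real.log_le_log_iff (by positivity) (by positivity), Real.log_pow, Real.log_div hδ.ne'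
      two_ne_zero, one_div, Real.log_inv]
    rw [one_div, Real.log_inv] at hk' hlogδ
    have h2 := Real.log_two_gt_d9
    nlinarith
  have htail : (k : ℝ) * (2 * Real.exp (-(2 * (T * l : ℕ) * (ε / 64) ^ 2))) ≤ δ / 2 := by
    have hq : 0 < (T : ℝ) * k / δ := by positivity
    have hlog : Real.log ((T : ℝ) * k / δ) < l * ε ^ 2 := by
      rwa [div_lt_iff₀ (by positivity)] at hl'
    -- As `T ≥ 4096`, the exponent is at least `2 l ε²`, which exceeds `2 log (T k / δ)`.
    have h1 : Real.exp (-(2 * (T * l : ℕ) * (ε / 64) ^ 2)) ≤ ((T : ℝ) * k / δ)⁻¹ ^ 2 := by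
      rw [← Real.exp_log hq, ← Real.exp_neg, ← Real.exp_nat_mul, Real.exp_le_exp]
      push_cast
      have : 4096 * ((l : ℝ) * ε ^ 2) ≤ T * (l * ε ^ 2) := by gcongr
      linarith
    calc (k : ℝ) * (2 * Real.exp (-(2 * (T * l : ℕ) * (ε / 64) ^ 2)))
        ≤ k * (2 * ((T : ℝ) * k / δ)⁻¹ ^ 2) := by gcongr
      _ = 2 * δ ^ 2 / (T ^ 2 * k) := by field_simp
      _ ≤ δ / 2 := by
        rw [div_le_iff₀ (by positivity)]
        have : (4 : ℝ) ≤ T ^ 2 * k := by nlinarith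
        nlinarith
  linarith
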